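/- **Setting.** Let $\mathcal S\subset\mathbb R^k$ be compact with Euclidean diameter $d_s$, let $\mathcal A$ be a measurable action space, and let $\mu$ be a probability measure on a measurable parameter space $\Xi$. Let $p_\xi(\cdot\mid s,a)$, $\xi\in\Xi$, be simulated transition kernels and $p^\star(\cdot\mid s,a)$ the real transition kernel from $\mathcal S\times\mathcal A$ to $\mathcal S$ ($p_\xi$ depending measurably on $(\xi,s,a)$), and let $p_\mu\triangleq\mathbb E_{\xi\sim\mu}[p_\xi]$ be the domain-randomization kernel. For probability measures $P_1,P_2$ on $\mathcal S$ let $$D_W(P_1,P_2)=\inf_{\gamma}\int_{\mathcal S\times\mathcal S}\|s_1-s_2\|_2\,\gamma(ds_1\times ds_2),$$ where $\gamma$ runs over the couplings of $P_1$ and $P_2$, and write $D_W(p_\xi,p^\star)(s,a)=D_W(p_\xi(\cdot\mid s,a),p^\star(\cdot\mid s,a))$. For $(s,a)\in\mathcal S\times\mathcal A$ and i.i.d. draws $s_1,\dots,s_n$ from $p_\mu(\cdot\mid s,a)$, $n\ge1$, let $$\upsilon(s,a)=\sum_{j=1}^{k}\mathrm{Var}(s_{1,j},\dots,s_{n,j}),\qquad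 \mathrm{Var}(y_1,\dots,y_n)=\frac1n\sum_{i=1}^n\Big(y_i-\frac1n\sum_{l=1}^n y_l\Big)^2 .$$ **Theorem.** For every $\alpha\in(0,1)$ and every $d_s$ there are constants $C_1,C_2,C_3,C_4>0$, depending only on $\alpha$ and $d_s$, such that the following holds for every setting as above with diameter $d_s$. Let $\varepsilon>0$ be such that for all $(s,a)\in\mathcal S\times\mathcal A$ $$\mathrm{KL}\big(p^\star(\cdot\mid s,a),p_\mu(\cdot\mid s,a)\big)\le\varepsilon\quad\text{and}\quad \sup_{\xi\in\Xi}\mathrm{KL}\big(p_\xi(\cdot\mid s,a),p_\mu(\cdot\mid s,a)\big)\le\varepsilon .$$ Then for every $(s,a)\in\mathcal S\times\mathcal A$ and every $n\ge1$, with probability at least $1-\alpha$ over the draws $s_1,\dots,s_n$, $$\sup_{\xi\in\Xi}D_W(p_\xi,p^\star)(s,a)\le C_1\,\upsilon(s,a)+C_2\,\varepsilon+\sqrt{\frac{C_3}{n}}+\frac{C_4}{n}.$$ In particular this holds, with the same constants, under the additional non-degeneracy assumption that $\frac1n\sum_{i=1}^n\|s_i-\bar s\|_2\ge c_3>0$,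 where $\bar s=\frac1n\sum_{i=1}^n s_i$. -/

import Mathlib

open MeasureTheory ProbabilityTheory
open scoped ENNReal

noncomputable section

/-- The set of couplings of two measures: measures on the product with the given marginals. -/
def couplings {X : Type*} [MeasurableSpace X] (P₁ P₂ : Measure X) : Set (Measure (X × X)) :=
  {γ | γ.fst = P₁ ∧ γ.snd = P₂}

/-- The `L₁`-Wasserstein distance, as an infimum of transport costs over all couplings. -/
def wassersteinDist {X : Type*} [MeasurableSpace X] [PseudoEMetricSpace X]
    (P₁ P₂ : Measure X) : ℝ≥0∞ :=
  ⨅ γ ∈ couplings P₁ P₂, ∫⁻ z, edist z.1 z.2 ∂γ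

/-- The domain-randomization kernel `p_μ = 𝔼_{ξ ∼ μ}[p_ξ]`, at the state-action pair `x`. -/
def domainRandomization {Ξ X S : Type*} [MeasurableSpace Ξ] [MeasurableSpace X]
    [MeasurableSpace S] (μ : Measure Ξ) (p : Kernel (Ξ × X) S) (x : X) : Measure S :=
  μ.bind fun ξ => p (ξ, x)

/-- The empirical mean of `n` real numbers. -/
def empiricalMean {n : ℕ} (y : Fin n → ℝ) : ℝ := (∑ i, y i) / n

/-- The empirical variance of `n` real numbers (the variance of the empirical measure). -/
def empiricalVar {n : ℕ} (y : Fin n → ℝ) : ℝ := (∑ i, (y i - empiricalMean y) ^ 2) / n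

/-- The sum over the components of the empirical variances of `n` vectors. -/
def ensembleVar {k n : ℕ} (y : Fin n → EuclideanSpace ℝ (Fin k)) : ℝ :=
  ∑ j, empiricalVar fun i => y i j

end

/-! Let `ν` be the randomized kernel at the given pair, `m` its mean and `V` its total variance.
Finite divergence gives each of the two kernels a density against `ν`. Moving only the mass on which
the densities differ, with cost at most `h x + h y` for `h = ‖· - m‖`, bounds the distance by the
`h`-weighted total variation, and hence by the deviations of both densities from `1`. The Young
bound `h * |t - 1| ≤ klFun t + exp D * h ^ 2` then yields `2 * ε + 2 * exp D * V`, linear in the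
divergence and in the variance (`wassersteinDist_le_klDiv_add`).

Randomness enters only in replacing `V` by the ensemble variance, through Chebyshev and Markov
(`prob_variance_le_ensembleVar_add`). That event does not involve `ξ`, so the supremum costs
nothing. -/

/-! ### Transport inequality -/

/-- Young's inequality for the Kullback-Leibler function, on a bounded range. -/
lemma mul_abs_sub_one_le_klFun_add {h D t : ℝ} (hh : 0 ≤ h) (hD : h ≤ D) (ht : 0 ≤ t) :
    h * |t - 1| ≤ InformationTheory.klFun t + Real.exp D * h ^ 2 := by
  -- Fenchel–Young: `exp u - 1 - u` is the convex conjugate of `klFun` in the variable `t - 1`. It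
  -- is used at `u = h` or `u = -h`, following the sign of `t - 1`.
  have young (u : ℝ) : u * (t - 1) ≤ InformationTheory.klFun t + (Real.exp u - 1 - u) := by
    unfold InformationTheory.klFun
    rcases ht.eq_or_lt with rfl | ht
    · simp; linarith [Real.exp_pos u]
    · have h1 := Real.add_one_le_exp (u - Real.log t)
      rw [Real.exp_sub, Real.exp_log ht, le_div_iff₀ ht] at h1
      linarith
  -- Makes the remainder quadratic: `exp h - 1 - h ≤ h * (exp h - 1) ≤ h ^ 2 * exp h`.
  have hexp (u : ℝ) : Real.exp u - 1 ≤ u * Real.exp u := by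
    have h1 := mul_le_mul_of_nonneg_right (Real.add_one_le_exp (-u)) (Real.exp_pos u).le
    rw [← Real.exp_add] at h1
    simp at h1
    linarith
  have hD1 : 1 ≤ Real.exp D := Real.one_le_exp (hh.trans hD)
  have hle : Real.exp h ≤ Real.exp D := Real.exp_le_exp.2 hD
  rcases abs_cases (t - 1) with ⟨h1, h2⟩ | ⟨h1, h2⟩ <;> rw [h1]
  · have h3 := young h
    have h4 := hexp h
    nlinarith [mul_le_mul_of_nonneg_left h4 hh, mul_le_mul_of_nonneg_right hle (sq_nonneg h)]
  · have h3 := young (-h)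
    have h4 := hexp (-h)
    have h5 := Real.add_one_le_exp (-h)
    nlinarith [mul_le_mul_of_nonneg_left h5 hh, mul_le_mul_of_nonneg_right hD1 (sq_nonneg h)]

/-- Transporting only the excess mass bounds the Wasserstein distance by a weighted total
variation distance. -/
lemma wassersteinDist_withDensity_le {X : Type*} [MeasurableSpace X] [PseudoEMetricSpace X]
    [OpensMeasurableSpace X] [SecondCountableTopology X]
    (ν : Measure X) {f g h : X → ℝ≥0∞}
    (hf : Measurable f) (hg : Measurable g) (hh : Measurable h)
    (hfin : ∫⁻ x, f x ∂ν ≠ ∞) (hfg : ∫⁻ x, f x ∂ν = ∫⁻ x, g x ∂ν)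
    (hedist : ∀ x y, edist x y ≤ h x + h y) :
    wassersteinDist (ν.withDensity f) (ν.withDensity g)
      ≤ ∫⁻ x, h x * ((f x - g x) + (g x - f x)) ∂ν := by
  -- `c` is the mass common to both measures; `r` and `r'` are the excesses, of equal total mass.
  set c := ν.withDensity (fun x => min (f x) (g x)) with hc
  set r := ν.withDensity (fun x => f x - g x) with hr
  set r' := ν.withDensity (fun x => g x - f x) with hr'
  have hmin : Measurable fun x => min (f x) (g x) := hf.min hg
  have hcr : c + r = ν.withDensity f := by
    rw [hc, hr, ← withDensity_add_left hmin]
    congr 1; ext x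
    simp only [Pi.add_apply]
    rcases le_total (f x) (g x) with h | h
    · simp [h, tsub_eq_zero_of_le h]
    · simp [h, add_tsub_cancel_of_le h]
  have hcr' : c + r' = ν.withDensity g := by
    rw [hc, hr', ← withDensity_add_left hmin]
    congr 1; ext x
    simp only [Pi.add_apply]
    rcases le_total (f x) (g x) with h | h
    · simp [h, add_tsub_cancel_of_le h]
    · simp [h, tsub_eq_zero_of_le h]
  have hF : ν.withDensity f Set.univ = ∫⁻ x, f x ∂ν := by simp
  have hG : ν.withDensity g Set.univ = ∫⁻ x, g x ∂ν := by simp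
  have hFG : c Set.univ + r Set.univ = c Set.univ + r' Set.univ := by
    rw [← Measure.add_apply, ← Measure.add_apply, hcr, hcr', hF, hG, hfg]
  have htop : c Set.univ + r Set.univ ≠ ∞ := by
    rw [← Measure.add_apply, hcr, hF]; exact hfin
  have hrt : r Set.univ ≠ ∞ := (ENNReal.add_ne_top.1 htop).2
  have hM : r Set.univ = r' Set.univ :=
    (ENNReal.add_right_inj (ENNReal.add_ne_top.1 htop).1).1 hFG
  have : IsFiniteMeasure r := ⟨hrt.lt_top⟩
  have : IsFiniteMeasure r' := ⟨(hM ▸ hrt).lt_top⟩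
  -- If there is no excess, the inverse is `∞`, but it only ever multiplies `0`.
  have hscale : ∀ a : ℝ≥0∞, (r Set.univ = 0 → a = 0) →
      (r Set.univ)⁻¹ * (r Set.univ * a) = a := by
    intro a ha
    by_cases h0 : r Set.univ = 0
    · simp [ha h0]
    · rw [← mul_assoc, ENNReal.inv_mul_cancel h0 hrt, one_mul]
  have hnull : ∀ s, r Set.univ = 0 → r s = 0 := fun s h0 => measure_mono_null (Set.subset_univ s) h0
  have hnull' : ∀ s, r Set.univ = 0 → r' s = 0 :=
    fun s h0 => measure_mono_null (Set.subset_univ s) (hM ▸ h0)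
  have hdiag : Measurable fun x : X => (x, x) := measurable_id.prodMk measurable_id
  -- Common mass stays on the diagonal, at no cost; the excesses are coupled independently.
  set γ := c.map (fun x => (x, x)) + (r Set.univ)⁻¹ • r.prod r' with hγ
  have hγm : γ ∈ couplings (ν.withDensity f) (ν.withDensity g) := by
    refine ⟨?_, ?_⟩
    · rw [← hcr]
      ext s hs
      rw [Measure.fst_apply hs, hγ, Measure.add_apply, Measure.smul_apply,
        Measure.map_apply hdiag (measurable_fst hs), Measure.add_apply, ← Set.prod_univ,
        Measure.prod_prod, ← hM, smul_eq_mul, mul_comm (r s), hscale _ (hnull s)]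
      congr 2; ext; simp
    · rw [← hcr']
      ext s hs
      rw [Measure.snd_apply hs, hγ, Measure.add_apply, Measure.smul_apply,
        Measure.map_apply hdiag (measurable_snd hs), Measure.add_apply, ← Set.univ_prod,
        Measure.prod_prod, smul_eq_mul, hscale _ (hnull' s)]
      congr 2; ext; simp
  have hr0 : r Set.univ = 0 → r = 0 := Measure.measure_univ_eq_zero.1
  have hr0' : r Set.univ = 0 → r' = 0 := fun h0 => Measure.measure_univ_eq_zero.1 (hM ▸ h0)
  calc wassersteinDist (ν.withDensity f) (ν.withDensity g)
      ≤ ∫⁻ z, edist z.1 z.2 ∂γ := iInf₂_le γ hγm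
    _ = (r Set.univ)⁻¹ * ∫⁻ z, edist z.1 z.2 ∂(r.prod r') := by
      rw [hγ, lintegral_add_measure, lintegral_smul_measure,
        lintegral_map (by fun_prop) hdiag]
      simp
    _ ≤ (r Set.univ)⁻¹ * ∫⁻ z, (h z.1 + h z.2) ∂(r.prod r') := by
      gcongr with z; exact hedist _ _
    _ = (r Set.univ)⁻¹ * (r Set.univ * (∫⁻ x, h x ∂r + ∫⁻ x, h x ∂r')) := by
      congr 1
      rw [lintegral_add_left (by fun_prop), lintegral_prod _ (by fun_prop),
        lintegral_prod _ (by fun_prop)]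
      simp [lintegral_mul_const _ hh, ← hM]
      ring
    _ = ∫⁻ x, h x ∂r + ∫⁻ x, h x ∂r' := hscale _ fun h0 => by simp [hr0 h0, hr0' h0]
    _ = ∫⁻ x, h x * ((f x - g x) + (g x - f x)) ∂ν := by
      have hfm : Measurable fun x => f x - g x := hf.sub hg
      have hgm : Measurable fun x => g x - f x := hg.sub hf
      rw [hr, hr', lintegral_withDensity_eq_lintegral_mul _ hfm hh,
        lintegral_withDensity_eq_lintegral_mul _ hgm hh,
        ← lintegral_add_left (hfm.mul hh)]
      congr 1; ext x; simp only [Pi.mul_apply]; ring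

/-- Integrated Young inequality: a weighted total variation distance is controlled by the
Kullback-Leibler divergence and the second moment of the weight. -/
lemma lintegral_mul_rnDeriv_sub_one_le {X : Type*} [MeasurableSpace X]
    (p ν : Measure X) [IsFiniteMeasure p] [IsFiniteMeasure ν] {h : X → ℝ} {D : ℝ}
    (hh : Measurable h) (h0 : ∀ x, 0 ≤ h x) (hD : ∀ x, h x ≤ D) (hac : p ≪ ν) :
    ∫⁻ x, ENNReal.ofReal (h x) * ((p.rnDeriv ν x - 1) + (1 - p.rnDeriv ν x)) ∂ν
      ≤ InformationTheory.klDiv p ν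
        + ENNReal.ofReal (Real.exp D) * ∫⁻ x, ENNReal.ofReal (h x ^ 2) ∂ν := by
  rw [InformationTheory.klDiv_eq_lintegral_klFun_of_ac hac,
    ← lintegral_const_mul _ (by fun_prop), ← lintegral_add_right _ (by fun_prop)]
  refine lintegral_mono_ae ?_
  filter_upwards [p.rnDeriv_lt_top ν] with x hx
  -- Subtraction in `ℝ≥0∞` truncates, so one of the two summands always vanishes.
  have hsub : (p.rnDeriv ν x - 1) + (1 - p.rnDeriv ν x)
      = ENNReal.ofReal |(p.rnDeriv ν x).toReal - 1| := by
    set t := (p.rnDeriv ν x).toReal with ht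
    rw [← ENNReal.ofReal_toReal hx.ne, ← ht, ← ENNReal.ofReal_one,
      ← ENNReal.ofReal_sub _ zero_le_one, ← ENNReal.ofReal_sub _ (by positivity)]
    rcases le_total t 1 with h | h
    · rw [ENNReal.ofReal_of_nonpos (by linarith), abs_of_nonpos (by linarith)]; simp
    · rw [ENNReal.ofReal_of_nonpos (p := 1 - t) (by linarith), abs_of_nonneg (by linarith)]; simp
  rw [hsub, ← ENNReal.ofReal_mul (h0 x), ← ENNReal.ofReal_mul (Real.exp_pos _).le,
    ← ENNReal.ofReal_add (InformationTheory.klFun_nonneg (by positivity)) (by positivity)]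
  exact ENNReal.ofReal_le_ofReal
    (mul_abs_sub_one_le_klFun_add (h0 x) (hD x) (by positivity))

/-- A transport inequality: two measures close to `ν` in Kullback-Leibler divergence are close in
Wasserstein distance, up to a second moment of `ν`. -/
lemma wassersteinDist_le_klDiv_add {X : Type*} [MeasurableSpace X] [PseudoEMetricSpace X]
    [OpensMeasurableSpace X] [SecondCountableTopology X]
    (p q ν : Measure X) [IsProbabilityMeasure p] [IsProbabilityMeasure q] [IsFiniteMeasure ν]
    {h : X → ℝ} {D : ℝ} (hh : Measurable h) (h0 : ∀ x, 0 ≤ h x) (hD : ∀ x, h x ≤ D)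
    (hedist : ∀ x y, edist x y ≤ ENNReal.ofReal (h x) + ENNReal.ofReal (h y))
    (hp : p ≪ ν) (hq : q ≪ ν) :
    wassersteinDist p q ≤ InformationTheory.klDiv p ν + InformationTheory.klDiv q ν
      + 2 * (ENNReal.ofReal (Real.exp D) * ∫⁻ x, ENNReal.ofReal (h x ^ 2) ∂ν) := by
  have hfp : ∫⁻ x, p.rnDeriv ν x ∂ν = 1 := by rw [Measure.lintegral_rnDeriv hp, measure_univ]
  have hfq : ∫⁻ x, q.rnDeriv ν x ∂ν = 1 := by rw [Measure.lintegral_rnDeriv hq, measure_univ]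
  have hW := wassersteinDist_withDensity_le ν (Measure.measurable_rnDeriv p ν)
    (Measure.measurable_rnDeriv q ν) (hh.ennreal_ofReal) (by simp [hfp]) (hfp.trans hfq.symm)
    hedist
  rw [Measure.withDensity_rnDeriv_eq _ _ hp, Measure.withDensity_rnDeriv_eq _ _ hq] at hW
  calc wassersteinDist p q ≤ _ := hW
    _ ≤ ∫⁻ x, (ENNReal.ofReal (h x) * ((p.rnDeriv ν x - 1) + (1 - p.rnDeriv ν x))
          + ENNReal.ofReal (h x) * ((q.rnDeriv ν x - 1) + (1 - q.rnDeriv ν x))) ∂ν := by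
      -- Triangle inequality through `1`, the density of `ν` itself.
      refine lintegral_mono fun x => ?_
      rw [← mul_add]
      refine mul_le_mul_right ((add_le_add (tsub_le_tsub_add_tsub (b := 1))
        (tsub_le_tsub_add_tsub (b := 1))).trans (le_of_eq ?_)) _
      ring
    _ = _ := lintegral_add_left (by fun_prop) _
    _ ≤ _ := add_le_add (lintegral_mul_rnDeriv_sub_one_le p ν hh h0 hD hp)
      (lintegral_mul_rnDeriv_sub_one_le q ν hh h0 hD hq)
    _ = _ := by ring

/-! ### Concentration of the ensemble variance -/

/-- Bias–variance identity around an arbitrary centre. Taking `c` to be the true mean makes the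
summands centred. -/
lemma empiricalVar_eq_sub {n : ℕ} (hn : 0 < n) (y : Fin n → ℝ) (c : ℝ) :
    empiricalVar y = (∑ i, (y i - c) ^ 2) / n - ((∑ i, (y i - c)) / n) ^ 2 := by
  have hn' : (n : ℝ) ≠ 0 := by positivity
  have h1 : (∑ i, (y i - c)) = n * (empiricalMean y - c) := by
    simp [empiricalMean, Finset.sum_sub_distrib]; field_simp
  have h2 : ∑ i, (y i - empiricalMean y) ^ 2 =
      ∑ i, (y i - c) ^ 2 - 2 * (empiricalMean y - c) * ∑ i, (y i - c)
        + n * (empiricalMean y - c) ^ 2 := by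
    rw [Finset.mul_sum, ← Finset.sum_sub_distrib]
    have : (n : ℝ) * (empiricalMean y - c) ^ 2 = ∑ _i : Fin n, (empiricalMean y - c) ^ 2 := by simp
    rw [this, ← Finset.sum_add_distrib]
    exact Finset.sum_congr rfl fun i _ => by ring
  rw [empiricalVar, h2, h1]
  field_simp
  ring

lemma ensembleVar_eq_sub {k n : ℕ} (hn : 0 < n) (y : Fin n → EuclideanSpace ℝ (Fin k))
    (m : EuclideanSpace ℝ (Fin k)) :
    ensembleVar y = (∑ i, ‖y i - m‖ ^ 2) / n - ∑ j, ((∑ i, (y i j - m j)) / n) ^ 2 := by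
  have h1 j : empiricalVar (fun i => y i j)
      = (∑ i, (y i j - m j) ^ 2) / n - ((∑ i, (y i j - m j)) / n) ^ 2 :=
    empiricalVar_eq_sub hn _ _
  simp_rw [ensembleVar, h1, Finset.sum_sub_distrib, ← Finset.sum_div,
    EuclideanSpace.real_norm_sq_eq]
  rw [Finset.sum_comm]
  simp

/-- The squared deviation of the mean of independent vectors from their common expectation is at
most `D ^ 2 / n` on average. -/
lemma integral_sum_sq_mean_sub_le {Ω : Type*} [MeasurableSpace Ω] {P : Measure Ω}
    [IsProbabilityMeasure P] {k n : ℕ} (hn : 0 < n) {Y : Fin n → Ω → EuclideanSpace ℝ (Fin k)}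
    (hY : ∀ i, Measurable (Y i)) (hind : iIndepFun Y P) {m : EuclideanSpace ℝ (Fin k)}
    (hm : ∀ i j, ∫ ω, Y i ω j ∂P = m j) {D : ℝ} (hD : ∀ i ω, ‖Y i ω - m‖ ≤ D) :
    Integrable (fun ω => ∑ j, ((∑ i, (Y i ω j - m j)) / n) ^ 2) P ∧
      ∫ ω, ∑ j, ((∑ i, (Y i ω j - m j)) / n) ^ 2 ∂P ≤ D ^ 2 / n := by
  have hn' : (0 : ℝ) < n := by positivity
  have hbd i j ω : |Y i ω j - m j| ≤ D := by
    have := (PiLp.norm_apply_le (Y i ω - m) j).trans (hD i ω)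
    simpa using this
  have hmeas i j : Measurable fun ω => Y i ω j - m j := by
    have := hY i
    fun_prop
  have hL i j : MemLp (fun ω => Y i ω j - m j) 2 P :=
    MemLp.of_bound (hmeas i j).aestronglyMeasurable D
      (Filter.Eventually.of_forall fun ω => hbd i j ω)
  have hzero i j : ∫ ω, (Y i ω j - m j) ∂P = 0 := by
    have hint : Integrable (fun ω => Y i ω j) P := by
      refine (((hL i j).integrable (by norm_num)).add (integrable_const (m j))).congr
        (Filter.Eventually.of_forall fun ω => ?_)
      simp
    rw [integral_sub hint (integrable_const _), hm]; simp
  have hsumL j : MemLp (fun ω => ∑ i, (Y i ω j - m j)) 2 P :=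
    memLp_finsetSum _ fun i _ => hL i j
  -- Cross terms vanish by pairwise independence.
  have hvar j : ∫ ω, (∑ i, (Y i ω j - m j)) ^ 2 ∂P = ∑ i, ∫ ω, (Y i ω j - m j) ^ 2 ∂P := by
    have h1 := IndepFun.variance_sum (μ := P) (s := Finset.univ)
      (X := fun i ω => Y i ω j - m j) (fun i _ => hL i j) (fun i _ i' _ hne =>
        (hind.indepFun hne).comp (φ := fun v : EuclideanSpace ℝ (Fin k) => v j - m j)
          (ψ := fun v : EuclideanSpace ℝ (Fin k) => v j - m j) (by fun_prop) (by fun_prop))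
    have h2 : (∑ i, fun ω => Y i ω j - m j) = fun ω => ∑ i, (Y i ω j - m j) := by
      ext ω; simp
    rw [h2, variance_of_integral_eq_zero (hsumL j).aemeasurable] at h1
    · rw [h1]
      exact Finset.sum_congr rfl fun i _ =>
        variance_of_integral_eq_zero (hL i j).aemeasurable (hzero i j)
    · rw [integral_finsetSum _ fun i _ => (hL i j).integrable (by norm_num)]
      simp [hzero]
  have hint j : Integrable (fun ω => ((∑ i, (Y i ω j - m j)) / n) ^ 2) P := by
    simp_rw [div_pow]
    exact (hsumL j).integrable_sq.div_const _
  refine ⟨integrable_finsetSum _ fun j _ => hint j, ?_⟩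
  rw [integral_finsetSum _ fun j _ => hint j]
  simp_rw [div_pow, integral_div, hvar]
  -- Summing over coordinates first lets `D ^ 2` bound a whole squared norm, which keeps `k` out of
  -- the constant.
  rw [← Finset.sum_div, Finset.sum_comm]
  have hi i : ∑ j, ∫ ω, (Y i ω j - m j) ^ 2 ∂P ≤ D ^ 2 := by
    rw [← integral_finsetSum _ fun j _ => (hL i j).integrable_sq]
    have : ∫ ω, ∑ j, (Y i ω j - m j) ^ 2 ∂P ≤ ∫ _, D ^ 2 ∂P := by
      refine integral_mono (integrable_finsetSum _ fun j _ => (hL i j).integrable_sq)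
        (integrable_const _) fun ω => ?_
      have h1 := EuclideanSpace.real_norm_sq_eq (Y i ω - m)
      simp only [PiLp.sub_apply] at h1
      simp only [← h1]
      exact pow_le_pow_left₀ (norm_nonneg _) (hD i ω) 2
    simpa using this
  calc _ ≤ (∑ _i : Fin n, D ^ 2) / (n : ℝ) ^ 2 := by gcongr with i; exact hi i
    _ = D ^ 2 / n := by simp; field_simp

/-- Variance of an average of independent variables with values in `[0, B]`. -/
lemma variance_mean_le {Ω : Type*} [MeasurableSpace Ω] {P : Measure Ω}
    [IsProbabilityMeasure P] {n : ℕ} (hn : 0 < n) {Z : Fin n → Ω → ℝ}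
    (hZ : ∀ i, Measurable (Z i)) (hind : iIndepFun Z P) {B : ℝ}
    (hB : ∀ i ω, Z i ω ∈ Set.Icc 0 B) :
    variance (fun ω => (∑ i, Z i ω) / n) P ≤ B ^ 2 / n := by
  have hn' : (0 : ℝ) < n := by positivity
  have hL i : MemLp (Z i) 2 P :=
    memLp_of_bounded (Filter.Eventually.of_forall (hB i)) (hZ i).aestronglyMeasurable 2
  have h1 := IndepFun.variance_sum (μ := P) (s := Finset.univ) (fun i _ => hL i)
    (fun i _ i' _ hne => hind.indepFun hne)
  have h2 : (fun ω => (∑ i, Z i ω) / n) = fun ω => (n : ℝ)⁻¹ * (∑ i, Z i) ω := by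
    ext ω; simp [div_eq_inv_mul]
  have hv i : variance (Z i) P ≤ B ^ 2 := by
    refine (variance_le_sq_of_bounded (Filter.Eventually.of_forall (hB i))
      (hZ i).aemeasurable).trans ?_
    nlinarith [sq_nonneg B]
  rw [h2, variance_const_mul, h1]
  calc _ ≤ ((n : ℝ)⁻¹) ^ 2 * ∑ _i : Fin n, B ^ 2 := by gcongr with i; exact hv i
    _ = B ^ 2 / n := by simp; field_simp

/-- With high probability the ensemble variance dominates the true variance, up to terms vanishing
with the number of samples. -/
lemma prob_variance_le_ensembleVar_add {Ω : Type*} [MeasurableSpace Ω] {P : Measure Ω}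
    [IsProbabilityMeasure P] {k n : ℕ} (hn : 0 < n) {Y : Fin n → Ω → EuclideanSpace ℝ (Fin k)}
    (hY : ∀ i, Measurable (Y i)) (hind : iIndepFun Y P) {m : EuclideanSpace ℝ (Fin k)}
    (hm : ∀ i j, ∫ ω, Y i ω j ∂P = m j) {D : ℝ} (hD0 : 0 < D) (hD : ∀ i ω, ‖Y i ω - m‖ ≤ D)
    {V : ℝ} (hV : ∀ i, ∫ ω, ‖Y i ω - m‖ ^ 2 ∂P = V) {α : ℝ} (hα : 0 < α) :
    ENNReal.ofReal (1 - α) ≤ P {ω | V ≤ ensembleVar (fun i => Y i ω)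
      + √(2 * D ^ 4 / α / n) + 2 * D ^ 2 / α / n} := by
  have hn' : (0 : ℝ) < n := by positivity
  set Z : Ω → ℝ := fun ω => (∑ i, ‖Y i ω - m‖ ^ 2) / n with hZ
  set R : Ω → ℝ := fun ω => ∑ j, ((∑ i, (Y i ω j - m j)) / n) ^ 2 with hR
  -- `a` and `b` are chosen so that Chebyshev for `Z` and Markov for `R` each fail with probability
  -- at most `α / 2`.
  set a := √(2 * D ^ 4 / α / n) with ha
  set b := 2 * D ^ 2 / α / n with hb
  have ha0 : 0 < a := Real.sqrt_pos.2 (by positivity)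
  have hb0 : 0 < b := by positivity
  have hmeas i : Measurable fun ω => ‖Y i ω - m‖ ^ 2 := by
    have := hY i
    fun_prop
  have hbd i ω : ‖Y i ω - m‖ ^ 2 ∈ Set.Icc 0 (D ^ 2) :=
    ⟨by positivity, pow_le_pow_left₀ (norm_nonneg _) (hD i ω) 2⟩
  have hL i : MemLp (fun ω => ‖Y i ω - m‖ ^ 2) 2 P :=
    memLp_of_bounded (Filter.Eventually.of_forall (hbd i)) (hmeas i).aestronglyMeasurable 2
  have hZL : MemLp Z 2 P := by
    have : MemLp (fun ω => ∑ i, ‖Y i ω - m‖ ^ 2) 2 P := memLp_finsetSum _ fun i _ => hL i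
    simpa [hZ, div_eq_inv_mul] using this.const_mul (n : ℝ)⁻¹
  have hEZ : P[Z] = V := by
    simp only [hZ]
    rw [integral_div, integral_finsetSum _ fun i _ => (hL i).integrable (by norm_num)]
    simp [hV]; field_simp
  have hvar : variance Z P ≤ (D ^ 2) ^ 2 / n :=
    variance_mean_le hn hmeas (hind.comp (fun _ v => ‖v - m‖ ^ 2) fun _ => by fun_prop) hbd
  have hbadZ : P {ω | a ≤ |Z ω - V|} ≤ ENNReal.ofReal (α / 2) := by
    have h1 := meas_ge_le_variance_div_sq hZL ha0
    rw [hEZ] at h1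
    refine h1.trans (ENNReal.ofReal_le_ofReal ?_)
    rw [div_le_iff₀ (by positivity), ha, Real.sq_sqrt (by positivity)]
    refine hvar.trans (le_of_eq ?_)
    field_simp
  obtain ⟨hRint, hRle⟩ := integral_sum_sq_mean_sub_le hn hY hind hm hD
  have hbadR : P {ω | b ≤ R ω} ≤ ENNReal.ofReal (α / 2) := by
    have h1 := mul_meas_ge_le_integral_of_nonneg (μ := P) (f := R)
      (Filter.Eventually.of_forall fun ω => by simp only [hR, Pi.zero_apply]; positivity) hRint b
    rw [← ofReal_measureReal]
    refine ENNReal.ofReal_le_ofReal ?_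
    have h2 := h1.trans hRle
    rw [← le_div_iff₀' hb0] at h2
    refine h2.trans (le_of_eq ?_)
    rw [hb]; field_simp
  have hbad : P ({ω | a ≤ |Z ω - V|} ∪ {ω | b ≤ R ω}) ≤ ENNReal.ofReal α := by
    refine (measure_union_le _ _).trans ((add_le_add hbadZ hbadR).trans (le_of_eq ?_))
    rw [← ENNReal.ofReal_add (by positivity) (by positivity)]; congr 1; ring
  have hmZ : Measurable Z := by
    simp only [hZ]; exact (Finset.measurable_sum _ fun i _ => hmeas i).div_const _
  have hmR : Measurable R := by
    have hc i j : Measurable fun ω => Y i ω j - m j := by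
      have := hY i
      fun_prop
    simp only [hR]; fun_prop
  have hmbad : MeasurableSet ({ω | a ≤ |Z ω - V|} ∪ {ω | b ≤ R ω}) :=
    (measurableSet_le measurable_const (by fun_prop)).union (measurableSet_le measurable_const hmR)
  calc ENNReal.ofReal (1 - α) = 1 - ENNReal.ofReal α := by
        rw [ENNReal.ofReal_sub _ hα.le, ENNReal.ofReal_one]
    _ ≤ 1 - P ({ω | a ≤ |Z ω - V|} ∪ {ω | b ≤ R ω}) := tsub_le_tsub_left hbad _
    _ = P ({ω | a ≤ |Z ω - V|} ∪ {ω | b ≤ R ω})ᶜ := (prob_compl_eq_one_sub hmbad).symm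
    _ ≤ _ := by
      refine measure_mono fun ω hω => ?_
      simp only [Set.mem_compl_iff, Set.mem_union, Set.mem_ofPred_eq, not_or, not_le] at hω
      have h1 := ensembleVar_eq_sub hn (fun i => Y i ω) m
      have h2 := (abs_lt.1 hω.1).1
      change _ = Z ω - R ω at h1
      change V ≤ _
      linarith [hω.2]

/-! ### The main theorem -/

/-- A point of a set is within the diameter of the expectation of a random point of the set. -/
lemma norm_sub_integral_le_diam {E Ω : Type*} [NormedAddCommGroup E] [NormedSpace ℝ E]
    [CompleteSpace E] [MeasurableSpace Ω] {P : Measure Ω} [IsProbabilityMeasure P] {S : Set E}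
    (hS : Bornology.IsBounded S) {X : Ω → S} (hX : Integrable (fun ω => (X ω : E)) P) (x : S) :
    ‖(x : E) - ∫ ω, (X ω : E) ∂P‖ ≤ Metric.diam S := by
  have h1 : (x : E) - ∫ ω, (X ω : E) ∂P = ∫ ω, ((x : E) - X ω) ∂P := by
    rw [integral_sub (integrable_const _) hX]; simp
  rw [h1]
  refine (norm_integral_le_of_norm_le_const (C := Metric.diam S)
    (Filter.Eventually.of_forall fun ω => ?_)).trans (by simp)
  rw [← dist_eq_norm]
  exact Metric.dist_le_diam_of_mem hS x.2 (X ω).2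

theorem mainTheorem3 (α ds : ℝ) (hα : α ∈ Set.Ioo (0 : ℝ) 1) :
    ∃ C₁ > (0 : ℝ), ∃ C₂ > (0 : ℝ), ∃ C₃ > (0 : ℝ), ∃ C₄ > (0 : ℝ),
      ∀ (k : ℕ) (S : Set (EuclideanSpace ℝ (Fin k))) (_ : IsCompact S)
        (_ : Metric.diam S = ds)
        (A : Type*) [MeasurableSpace A] (Ξ : Type*) [MeasurableSpace Ξ]
        (μ : Measure Ξ) [IsProbabilityMeasure μ]
        (p : Kernel (Ξ × (S × A)) S) [IsMarkovKernel p]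
        (pstar : Kernel (S × A) S) [IsMarkovKernel pstar]
        (ε : ℝ) (_ : 0 < ε)
        (_ : ∀ x, InformationTheory.klDiv (pstar x) (domainRandomization μ p x)
          ≤ ENNReal.ofReal ε)
        (_ : ∀ x ξ, InformationTheory.klDiv (p (ξ, x)) (domainRandomization μ p x)
          ≤ ENNReal.ofReal ε)
        (s : S) (a : A) (n : ℕ) (_ : 0 < n)
        (Ω : Type*) [MeasurableSpace Ω] (P : Measure Ω) [IsProbabilityMeasure P]
        (X : Fin n → Ω → S) (_ : ∀ i, Measurable (X i)) (_ : iIndepFun X P)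
        (_ : ∀ i, P.map (X i) = domainRandomization μ p (s, a)),
        ENNReal.ofReal (1 - α) ≤ P {ω |
          (⨆ ξ, wassersteinDist (p (ξ, (s, a))) (pstar (s, a))) ≤
            ENNReal.ofReal (C₁ * ensembleVar (fun i => (X i ω : EuclideanSpace ℝ (Fin k)))
              + C₂ * ε + √(C₃ / n) + C₄ / n)} := by
  have hα0 := hα.1
  -- The added `1` keeps every constant positive when the diameter is zero.
  set D := |ds| + 1 with hDdef
  have hD0 : 0 < D := by positivity
  set K := 2 * Real.exp D with hK
  have hK0 : 0 < K := by positivity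
  -- The transport bound is `K * V + 2 * ε`; the deviation terms for `V` get multiplied by `K`,
  -- which enters the square root as `K ^ 2`.
  refine ⟨K, hK0, 2, two_pos, K ^ 2 * (2 * D ^ 4 / α), by positivity, K * (2 * D ^ 2 / α),
    by positivity, ?_⟩
  intro k S hS hdiam A _ Ξ _ μ _ p _ pstar _ ε hε hstar hp s a n hn Ω _ P _ X hX hind hlaw
  set ν := domainRandomization μ p (s, a) with hν
  have : IsProbabilityMeasure ν := by
    rw [← hlaw ⟨0, hn⟩]; exact Measure.isProbabilityMeasure_map (hX _).aemeasurable
  set m : EuclideanSpace ℝ (Fin k) := ∫ x, (x : EuclideanSpace ℝ (Fin k)) ∂ν with hm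
  have hint : Integrable (fun x : S => (x : EuclideanSpace ℝ (Fin k))) ν := by
    obtain ⟨C, hC⟩ := hS.isBounded.exists_norm_le
    exact Integrable.of_bound measurable_subtype_coe.aestronglyMeasurable C
      (Filter.Eventually.of_forall fun x => hC _ x.2)
  have hdist (x : S) : ‖(x : EuclideanSpace ℝ (Fin k)) - m‖ ≤ D := by
    have := norm_sub_integral_le_diam (X := fun x : S => x) hS.isBounded hint x
    linarith [le_abs_self ds]
  have hmean i j : ∫ ω, (X i ω : EuclideanSpace ℝ (Fin k)) j ∂P = m j := by
    have h1 := integral_map (μ := P) (hX i).aemeasurable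
      (f := fun x : S => (x : EuclideanSpace ℝ (Fin k)) j) (by
        exact (Measurable.aestronglyMeasurable (by fun_prop)))
    rw [← h1, hlaw i]
    exact (EuclideanSpace.proj (𝕜 := ℝ) j).integral_comp_comm hint
  have hmsq : Measurable fun x : S => ‖(x : EuclideanSpace ℝ (Fin k)) - m‖ ^ 2 := by fun_prop
  set V := ∫ x, ‖(x : EuclideanSpace ℝ (Fin k)) - m‖ ^ 2 ∂ν with hV
  have hvar i : ∫ ω, ‖(X i ω : EuclideanSpace ℝ (Fin k)) - m‖ ^ 2 ∂P = V := by
    rw [← integral_map (μ := P) (hX i).aemeasurable hmsq.aestronglyMeasurable, hlaw i]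
  have hprob := prob_variance_le_ensembleVar_add hn
    (Y := fun i ω => (X i ω : EuclideanSpace ℝ (Fin k)))
    (fun i => measurable_subtype_coe.comp (hX i))
    (hind.comp (fun _ x => (x : EuclideanSpace ℝ (Fin k))) fun _ => measurable_subtype_coe)
    hmean hD0 (fun i ω => hdist _) hvar hα0
  -- From here on the argument is deterministic, on the event that controls `V`.
  refine hprob.trans (measure_mono fun ω hω => ?_)
  simp only [Set.mem_ofPred_eq] at hω ⊢
  have hV0 : 0 ≤ V := integral_nonneg fun x => by positivity
  have hVl : ∫⁻ x, ENNReal.ofReal (‖(x : EuclideanSpace ℝ (Fin k)) - m‖ ^ 2) ∂ν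
      = ENNReal.ofReal V := by
    rw [hV, ofReal_integral_eq_lintegral_ofReal _
      (Filter.Eventually.of_forall fun x => by simp only [Pi.zero_apply]; positivity)]
    exact (memLp_of_bounded (Filter.Eventually.of_forall fun x : S =>
      (⟨by positivity, pow_le_pow_left₀ (norm_nonneg _) (hdist x) 2⟩ :
        ‖(x : EuclideanSpace ℝ (Fin k)) - m‖ ^ 2 ∈ Set.Icc 0 (D ^ 2)))
      hmsq.aestronglyMeasurable 1).integrable le_rfl
  have hac {q : Measure S} (hq : InformationTheory.klDiv q ν ≤ ENNReal.ofReal ε) : q ≪ ν :=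
    (InformationTheory.klDiv_ne_top_iff.1 (hq.trans_lt ENNReal.ofReal_lt_top).ne).1
  refine iSup_le fun ξ => ?_
  have hW := wassersteinDist_le_klDiv_add (p (ξ, (s, a))) (pstar (s, a)) ν
    (h := fun x : S => ‖(x : EuclideanSpace ℝ (Fin k)) - m‖) (D := D) (by fun_prop)
    (fun x => norm_nonneg _) hdist (fun x y => by
      rw [← ENNReal.ofReal_add (norm_nonneg _) (norm_nonneg _), edist_dist, Subtype.dist_eq]
      refine ENNReal.ofReal_le_ofReal ?_
      rw [← dist_eq_norm, ← dist_eq_norm]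
      exact dist_triangle_right _ _ _) (hac (hp _ _)) (hac (hstar _))
  calc _ ≤ _ := hW
    _ ≤ ENNReal.ofReal ε + ENNReal.ofReal ε
        + 2 * (ENNReal.ofReal (Real.exp D) * ENNReal.ofReal V) := by
      rw [hVl]
      gcongr
      exacts [hp _ _, hstar _]
    _ = ENNReal.ofReal (K * V + 2 * ε) := by
      rw [← ENNReal.ofReal_mul (Real.exp_pos _).le, ← ENNReal.ofReal_ofNat 2,
        ← ENNReal.ofReal_mul zero_le_two, ← ENNReal.ofReal_add hε.le hε.le,
        ← ENNReal.ofReal_add (by positivity) (by positivity)]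
      congr 1; rw [hK]; ring
    _ ≤ _ := by
      refine ENNReal.ofReal_le_ofReal ?_
      have hsqrt : √(K ^ 2 * (2 * D ^ 4 / α) / n) = K * √(2 * D ^ 4 / α / n) := by
        rw [mul_div_assoc, Real.sqrt_mul (by positivity), Real.sqrt_sq hK0.le]
      have h4 : K * (2 * D ^ 2 / α) / n = K * (2 * D ^ 2 / α / n) := mul_div_assoc _ _ _
      rw [hsqrt, h4]
      linarith [mul_le_mul_of_nonneg_left hω hK0.le]
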